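/- Let $n\ge 3$ and let $h:\mathbb R^n\to[0,\infty)$ be continuous with $h\in L^1(\mathbb R^n)\cap L^\infty(\mathbb R^n)$. Equip the real Sobolev space $H^1(\mathbb R^n)$ with the inner product $(u,v)_{H^1}=\int_{\mathbb R^n}(\nabla u\cdot\nabla v+uv)\,dx$ and the norm $\|u\|=(u,u)_{H^1}^{1/2}$. For $u\in H^1(\mathbb R^n)$ let $S(u)=w\in H^1(\mathbb R^n)$ be the unique weak solution of $-\Delta w+w=hu$, i.e. $(w,\phi)_{H^1}=\int_{\mathbb R^n} h\,u\,\phi\,dx$ for all $\phi\in H^1(\mathbb R^n)$. For $\mu\in\mathbb R$ let $N_\mu\subset H^1(\mathbb R^n)$ be the space of weak solutions of $-\Delta u+u=\mu h u$; $\mu$ is an eigenvalue if $N_\mu\ne\{0\}$. Let $\lambda_1<\lambda_2<\cdots$ be the distinct eigenvalues in increasing order, so that $\lambda_j$ is the eigenvalue for which exactly $j-1$ eigenvalues are smaller. Let $k\ge 1$, let $\lambda_k$ be the $k$-th eigenvalue, put $L=I-\lambda_k S$ on $H^1(\mathbb R^n)$, and let $X_+=N_{\lambda_{k+1}}\oplus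 N_{\lambda_{k+2}}\oplus\cdots$ be the closed linear span in $H^1(\mathbb R^n)$ of the spaces $N_{\lambda_j}$, $j>k$. Then $L$ is positive definite on $X_+$: there exists $\alpha>0$ such that $(Lu,u)_{H^1}\ge\alpha\|u\|^2$ for all $u\in X_+$. Moreover, with $\lambda_{k+1}$ the $(k+1)$-th eigenvalue, $\alpha=1-\lambda_k/\lambda_{k+1}>0$ has this property, i.e. $(Lu,u)_{H^1}\ge\left(1-\frac{\lambda_k}{\lambda_{k+1}}\right)\|u\|^2$ for all $u\in X_+$. -/

import Mathlib

open MeasureTheory Set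
open scoped ENNReal ContDiff

noncomputable section

namespace Resonance

/-- The Euclidean space `ℝⁿ`. -/
abbrev Rn (n : ℕ) : Type := EuclideanSpace ℝ (Fin n)

/-- The partial derivative `∂φ/∂xᵢ` at the point `x`. -/
def partialDeriv {n : ℕ} (φ : Rn n → ℝ) (i : Fin n) (x : Rn n) : ℝ :=
  fderiv ℝ φ x (EuclideanSpace.single i 1)

/-- `g` is the weak gradient of `u`: `∫ u ∂ᵢφ = -∫ gᵢ φ` for all `φ ∈ C_c^∞(ℝⁿ)` and all `i`. -/
def IsWeakGradient {n : ℕ} (u : Rn n → ℝ) (g : Rn n → Rn n) : Prop :=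
  ∀ φ : Rn n → ℝ, ContDiff ℝ ∞ φ → HasCompactSupport φ → ∀ i : Fin n,
    ∫ x, u x * partialDeriv φ i x = - ∫ x, g x i * φ x

/-- The Hilbert space `L²(ℝⁿ) × L²(ℝⁿ; ℝⁿ)` with `‖(u, g)‖² = ‖u‖² + ‖g‖²`. -/
abbrev L2Pair (n : ℕ) : Type :=
  WithLp 2 (Lp ℝ 2 (volume : Measure (Rn n)) × Lp (Rn n) 2 (volume : Measure (Rn n)))

lemma memLp_partialDeriv {n : ℕ} {φ : Rn n → ℝ} (hφ : ContDiff ℝ ∞ φ)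
    (hs : HasCompactSupport φ) (i : Fin n) :
    MemLp (partialDeriv φ i) 2 (volume : Measure (Rn n)) := by
  have hc : Continuous (partialDeriv φ i) :=
    (hφ.continuous_fderiv (by simp)).clm_apply continuous_const
  exact hc.memLp_of_hasCompactSupport (hs.fderiv_apply (𝕜 := ℝ) _)

lemma memLp_testVector {n : ℕ} {φ : Rn n → ℝ} (hφ : ContDiff ℝ ∞ φ)
    (hs : HasCompactSupport φ) (i : Fin n) :
    MemLp (fun x => φ x • (EuclideanSpace.single i 1 : Rn n)) 2 (volume : Measure (Rn n)) :=
  (hφ.continuous.smul continuous_const).memLp_of_hasCompactSupport hs.smul_right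

/-- On `L²` pairs the weak gradient identity is an identity of `L²` inner products. -/
lemma isWeakGradient_iff {n : ℕ} (p : L2Pair n) :
    IsWeakGradient (p.fst : Rn n → ℝ) (p.snd : Rn n → Rn n) ↔
      ∀ (φ : Rn n → ℝ) (hφ : ContDiff ℝ ∞ φ) (hs : HasCompactSupport φ) (i : Fin n),
        inner ℝ ((memLp_partialDeriv hφ hs i).toLp _) p.fst =
          - inner ℝ ((memLp_testVector hφ hs i).toLp _) p.snd := by
  refine forall_congr' fun φ => forall_congr' fun hφ => forall_congr' fun hs =>
    forall_congr' fun i => ?_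
  have h1 : inner ℝ ((memLp_partialDeriv hφ hs i).toLp _) p.fst =
      ∫ x, (p.fst : Rn n → ℝ) x * partialDeriv φ i x := by
    rw [L2.inner_def]
    refine integral_congr_ae ?_
    filter_upwards [(memLp_partialDeriv hφ hs i).coeFn_toLp] with x hx
    rw [hx]; simp
  have h2 : inner ℝ ((memLp_testVector hφ hs i).toLp _) p.snd =
      ∫ x, (p.snd : Rn n → Rn n) x i * φ x := by
    rw [L2.inner_def]
    refine integral_congr_ae ?_
    filter_upwards [(memLp_testVector hφ hs i).coeFn_toLp] with x hx
    rw [hx, real_inner_smul_left, EuclideanSpace.inner_single_left]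
    simp [mul_comm]
  rw [h1, h2]

/-- The Sobolev space `H¹(ℝⁿ)`, each function being taken together with its (unique) weak
gradient: the pairs `(u, ∇u)` with `u ∈ L²` and `∇u ∈ L²`. The inherited inner product is
`(u, v) = ∫ (∇u · ∇v + u v)`. -/
def sobolev (n : ℕ) : Submodule ℝ (L2Pair n) where
  carrier := {p | IsWeakGradient (p.fst : Rn n → ℝ) (p.snd : Rn n → Rn n)}
  zero_mem' := by
    rw [mem_ofPred_eq, isWeakGradient_iff]
    intro φ hφ hs i
    simp
  add_mem' := by
    intro p q hp hq
    rw [mem_ofPred_eq, isWeakGradient_iff] at *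
    intro φ hφ hs i
    rw [WithLp.add_fst, WithLp.add_snd, inner_add_right, inner_add_right,
      hp φ hφ hs i, hq φ hφ hs i]
    ring
  smul_mem' := by
    intro c p hp
    rw [mem_ofPred_eq, isWeakGradient_iff] at *
    intro φ hφ hs i
    rw [WithLp.smul_fst, WithLp.smul_snd, inner_smul_right, inner_smul_right, hp φ hφ hs i]
    ring

/-- `H¹(ℝⁿ)` as a type. -/
abbrev H1 (n : ℕ) : Type := sobolev n

lemma isClosed_sobolev (n : ℕ) : IsClosed (sobolev n : Set (L2Pair n)) := by
  have : (sobolev n : Set (L2Pair n)) =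
      ⋂ (φ : Rn n → ℝ) (hφ : ContDiff ℝ ∞ φ) (hs : HasCompactSupport φ) (i : Fin n),
        {p : L2Pair n | inner ℝ ((memLp_partialDeriv hφ hs i).toLp _) p.fst =
          - inner ℝ ((memLp_testVector hφ hs i).toLp _) p.snd} := by
    ext p
    simp only [mem_iInter, mem_ofPred_eq]
    exact isWeakGradient_iff p
  rw [this]
  refine isClosed_iInter fun φ => isClosed_iInter fun hφ => isClosed_iInter fun hs =>
    isClosed_iInter fun i => isClosed_eq ?_ ?_
  · exact continuous_const.inner (WithLp.continuous_fst _ _ _)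
  · exact (continuous_const.inner (WithLp.continuous_snd _ _ _)).neg

instance instCompleteSpaceH1 (n : ℕ) : CompleteSpace (H1 n) :=
  (isClosed_sobolev n).completeSpace_coe

/-- The function underlying an element of `H¹(ℝⁿ)`. -/
def H1.fn {n : ℕ} (u : H1 n) : Lp ℝ 2 (volume : Measure (Rn n)) := u.1.fst

/-- The weak gradient of an element of `H¹(ℝⁿ)`. -/
def H1.grad {n : ℕ} (u : H1 n) : Lp (Rn n) 2 (volume : Measure (Rn n)) := u.1.snd

lemma H1.inner_eq {n : ℕ} (u v : H1 n) :
    inner ℝ u v = (∫ x, inner ℝ (u.grad x) (v.grad x)) + ∫ x, u.fn x * v.fn x := by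
  rw [Submodule.coe_inner, WithLp.prod_inner_apply, L2.inner_def, L2.inner_def, add_comm]
  congr 1
  refine integral_congr_ae (Filter.Eventually.of_forall fun x => ?_)
  simp [H1.fn, mul_comm]

/-- `w ∈ H¹(ℝⁿ)` is a weak solution of `-Δw + w = f`:
`∫ ∇w · ∇φ + ∫ w φ = ∫ f φ` for all `φ ∈ H¹(ℝⁿ)`. -/
def IsWeakSolution {n : ℕ} (w : H1 n) (f : Rn n → ℝ) : Prop :=
  ∀ φ : H1 n, (∫ x, inner ℝ (w.grad x) (φ.grad x)) + (∫ x, w.fn x * φ.fn x) =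
    ∫ x, f x * φ.fn x

/-- The inclusion `H¹(ℝⁿ) → L²(ℝⁿ)`. -/
def inclL2 (n : ℕ) : H1 n →L[ℝ] Lp ℝ 2 (volume : Measure (Rn n)) :=
  (WithLp.fstL 2 ℝ (Lp ℝ 2 (volume : Measure (Rn n)))
    (Lp (Rn n) 2 (volume : Measure (Rn n)))).comp (sobolev n).subtypeL

/-- Multiplication by `h ∈ L^∞(ℝⁿ)` on `L²(ℝⁿ)`. -/
def mulL2 {n : ℕ} {h : Rn n → ℝ} (hb : MemLp h ∞ (volume : Measure (Rn n))) :
    Lp ℝ 2 (volume : Measure (Rn n)) →L[ℝ] Lp ℝ 2 (volume : Measure (Rn n)) :=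
  (ContinuousLinearMap.mul ℝ ℝ).holderL (volume : Measure (Rn n)) ∞ 2 2 hb.toLp

/-- The solution operator `S : H¹(ℝⁿ) → H¹(ℝⁿ)`: `S u` is the unique weak solution `w` of
`-Δw + w = h u` (see `isWeakSolution_iff`). -/
def solOp {n : ℕ} {h : Rn n → ℝ} (hb : MemLp h ∞ (volume : Measure (Rn n))) :
    H1 n →L[ℝ] H1 n :=
  (ContinuousLinearMap.adjoint (inclL2 n)).comp ((mulL2 hb).comp (inclL2 n))

lemma inner_solOp {n : ℕ} {h : Rn n → ℝ} (hb : MemLp h ∞ (volume : Measure (Rn n)))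
    (u φ : H1 n) : inner ℝ (solOp hb u) φ = ∫ x, h x * u.fn x * φ.fn x := by
  rw [solOp, ContinuousLinearMap.comp_apply, ContinuousLinearMap.adjoint_inner_left,
    L2.inner_def]
  refine integral_congr_ae ?_
  filter_upwards [(ContinuousLinearMap.mul ℝ ℝ).coeFn_holder (r := 2) hb.toLp (inclL2 n u),
    hb.coeFn_toLp] with x hx hx'
  have : (mulL2 hb (inclL2 n u) : Rn n → ℝ) x = h x * u.fn x := by
    refine hx.trans ?_
    rw [hx']; rfl
  rw [ContinuousLinearMap.comp_apply, this]
  simp [inclL2, H1.fn, mul_comm]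

/-- `w = c S u` holds exactly when `w` is a weak solution of `-Δw + w = c h u`. -/
lemma isWeakSolution_iff {n : ℕ} {h : Rn n → ℝ} (hb : MemLp h ∞ (volume : Measure (Rn n)))
    (c : ℝ) (w u : H1 n) :
    IsWeakSolution w (fun x => c * (h x * u.fn x)) ↔ w = c • solOp hb u := by
  have key : ∀ φ : H1 n, ∫ x, c * (h x * u.fn x) * φ.fn x = inner ℝ (c • solOp hb u) φ := by
    intro φ
    rw [real_inner_smul_left (F := H1 n), inner_solOp, ← integral_const_mul]
    simp only [mul_assoc]
  constructor
  · intro hw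
    refine ext_inner_right ℝ fun φ => ?_
    rw [H1.inner_eq, hw φ, key φ]
  · intro hw φ
    rw [← H1.inner_eq, key φ, ← hw]

/-- The space `N_μ` of the weak solutions `u ∈ H¹(ℝⁿ)` of `-Δu + u = μ h u`. -/
def eigenspace {n : ℕ} {h : Rn n → ℝ} (hb : MemLp h ∞ (volume : Measure (Rn n))) (μ : ℝ) :
    Submodule ℝ (H1 n) where
  carrier := {u | IsWeakSolution u (fun x => μ * (h x * u.fn x))}
  zero_mem' := (isWeakSolution_iff hb μ 0 0).2 (by simp)
  add_mem' := by
    intro u v hu hv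
    refine (isWeakSolution_iff hb μ _ _).2 ?_
    rw [map_add, smul_add, ← (isWeakSolution_iff hb μ _ _).1 hu,
      ← (isWeakSolution_iff hb μ _ _).1 hv]
  smul_mem' := by
    intro c u hu
    refine (isWeakSolution_iff hb μ _ _).2 ?_
    rw [map_smul, smul_comm, ← (isWeakSolution_iff hb μ _ _).1 hu]

/-- The set of eigenvalues `μ` of `-Δu + u = μ h u`, `u ∈ H¹(ℝⁿ)`. -/
def eigenvalues {n : ℕ} {h : Rn n → ℝ} (hb : MemLp h ∞ (volume : Measure (Rn n))) : Set ℝ :=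
  {μ | ∃ u ∈ eigenspace hb μ, u ≠ 0}

/-- `μ` is the `k`-th eigenvalue `λ_k` (`k = 1, 2, …`) in the increasing enumeration
`λ₁ < λ₂ < …` of the distinct eigenvalues: exactly `k - 1` eigenvalues are smaller. -/
def IsKthEigenvalue {n : ℕ} {h : Rn n → ℝ} (hb : MemLp h ∞ (volume : Measure (Rn n)))
    (k : ℕ) (μ : ℝ) : Prop :=
  μ ∈ eigenvalues hb ∧ {ν ∈ eigenvalues hb | ν < μ}.encard + 1 = k

/-- `X₊ = N_{λ_{k+1}} ⊕ N_{λ_{k+2}} ⊕ …`, the closed linear span in `H¹(ℝⁿ)` of the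
eigenspaces `N_{λ_j}`, `j > k`. -/
def Xplus {n : ℕ} {h : Rn n → ℝ} (hb : MemLp h ∞ (volume : Measure (Rn n))) (k : ℕ) :
    Submodule ℝ (H1 n) :=
  (⨆ (j : ℕ) (_ : k < j) (μ : ℝ) (_ : IsKthEigenvalue hb j μ),
    eigenspace hb μ).topologicalClosure

/-- The operator `L u = u - lam S u` on `H¹(ℝⁿ)`. -/
def opL {n : ℕ} {h : Rn n → ℝ} (hb : MemLp h ∞ (volume : Measure (Rn n))) (lam : ℝ) :
    H1 n →L[ℝ] H1 n :=
  ContinuousLinearMap.id ℝ (H1 n) - lam • solOp hb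

end Resonance

end

/-!
As `h ≥ 0`, the operator `S` is positive; so every `μ` with `N_μ ≠ 0` is positive, and `N_μ` is the
eigenspace of `S` for `1 / μ`. Hence `X₊` lies in the closed span of the eigenspaces of `S` for
eigenvalues at most `1 / λ_{k+1}`. These are mutually orthogonal, so `(S u, u) ≤ ‖u‖² / λ_{k+1}`
first on finite sums of eigenvectors and then, by continuity, on all of `X₊`. If there is no
`λ_{k+1}`, then `X₊ = 0` and any number above `λ_k` can take its place.
-/

namespace Resonance

section SymmetricOperator

variable {𝕜 E : Type*} [RCLike 𝕜] [NormedAddCommGroup E] [InnerProductSpace 𝕜 E] {c : ℝ} {u : E}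

lemma re_inner_map_self_le_of_mem_iSup_eigenspace {T : E →ₗ[𝕜] E} (hT : T.IsSymmetric)
    (hu : u ∈ ⨆ (a : 𝕜) (_ : RCLike.re a ≤ c), Module.End.eigenspace T a) :
    RCLike.re (inner 𝕜 (T u) u) ≤ c * ‖u‖ ^ 2 := by
  classical
  have horth := hT.orthogonalFamily_eigenspaces.comp
    (Subtype.val_injective (p := fun a : 𝕜 => RCLike.re a ≤ c))
  rw [iSup_subtype', Submodule.mem_iSup_iff_exists_dfinsupp'] at hu
  obtain ⟨f, rfl⟩ := hu
  have hTf : T (f.sum fun _ v => (v : E)) = ∑ a ∈ f.support, ((a.1 • f a :) : E) := by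
    rw [DFinsupp.sum, map_sum]
    exact Finset.sum_congr rfl fun a _ => Module.End.mem_eigenspace_iff.1 (f a).2
  calc RCLike.re (inner 𝕜 (T (f.sum fun _ v => (v : E))) (f.sum fun _ v => (v : E)))
      = RCLike.re (∑ a ∈ f.support, inner 𝕜 (a.1 • f a) (f a)) := by
        rw [hTf]
        exact congrArg _ (horth.inner_sum (fun a => a.1 • f a) f f.support)
    _ = ∑ a ∈ f.support, RCLike.re a.1 * ‖f a‖ ^ 2 := by
        rw [map_sum]
        refine Finset.sum_congr rfl fun a _ => ?_
        rw [inner_smul_left, inner_self_eq_norm_sq_to_K, ← RCLike.ofReal_pow,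
          RCLike.re_mul_ofReal, RCLike.conj_re]
    _ ≤ ∑ a ∈ f.support, c * ‖f a‖ ^ 2 := by
        gcongr with a
        exact a.2
    _ = c * ‖f.sum fun _ v => (v : E)‖ ^ 2 := by
        rw [← Finset.mul_sum]
        exact congrArg _ (horth.norm_sum f f.support).symm

lemma reApplyInnerSelf_le_of_mem_closure_iSup_eigenspace {T : E →L[𝕜] E}
    (hT : (T : E →ₗ[𝕜] E).IsSymmetric)
    (hu : u ∈ (⨆ (a : 𝕜) (_ : RCLike.re a ≤ c),
      Module.End.eigenspace (T : E →ₗ[𝕜] E) a).topologicalClosure) :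
    T.reApplyInnerSelf u ≤ c * ‖u‖ ^ 2 := by
  have hclosed : IsClosed {v : E | T.reApplyInnerSelf v ≤ c * ‖v‖ ^ 2} :=
    isClosed_le T.reApplyInnerSelf_continuous (by fun_prop)
  exact closure_minimal (fun v hv => re_inner_map_self_le_of_mem_iSup_eigenspace hT hv) hclosed hu

end SymmetricOperator

section KthElement

variable {α : Type*} [LinearOrder α] {s : Set α} {i j k : ℕ} {a b : α}

/-- `a` is the `k`-th smallest element of `s`, counting from `1`: exactly `k - 1` elements of `s`
are smaller. The condition is written additively, so that nothing is a `0`-th element. It is the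
order-theoretic content of `IsKthEigenvalue`. -/
def IsKthElement (s : Set α) (k : ℕ) (a : α) : Prop :=
  a ∈ s ∧ {b ∈ s | b < a}.encard + 1 = k

namespace IsKthElement

lemma index_le_of_le (ha : IsKthElement s i a) (hb : IsKthElement s j b) (hab : a ≤ b) :
    i ≤ j := by
  have hsub : {x ∈ s | x < a} ⊆ {x ∈ s | x < b} := fun x hx => ⟨hx.1, hx.2.trans_le hab⟩
  rw [← Nat.cast_le (α := ℕ∞), ← ha.2, ← hb.2]
  gcongr

lemma index_lt_of_lt (ha : IsKthElement s i a) (hb : IsKthElement s j b) (hab : a < b) :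
    i < j := by
  have hsub : insert a {x ∈ s | x < a} ⊆ {x ∈ s | x < b} :=
    insert_subset ⟨ha.1, hab⟩ fun x hx => ⟨hx.1, hx.2.trans hab⟩
  have hcard := encard_le_encard hsub
  rw [encard_insert_of_notMem fun hmem => lt_irrefl a hmem.2, ha.2] at hcard
  rw [← Nat.succ_le_iff, ← Nat.cast_le (α := ℕ∞), Nat.cast_succ, ← hb.2]
  gcongr

lemma lt_iff_index_lt (ha : IsKthElement s i a) (hb : IsKthElement s j b) : a < b ↔ i < j :=
  ⟨ha.index_lt_of_lt hb, fun hij => lt_of_not_ge fun hba => hij.not_ge (hb.index_le_of_le ha hba)⟩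

lemma le_iff_index_le (ha : IsKthElement s i a) (hb : IsKthElement s j b) : a ≤ b ↔ i ≤ j := by
  simpa only [not_lt] using (hb.lt_iff_index_lt ha).not

lemma exists_gt_forall_le [NoMaxOrder α] (ha : IsKthElement s k a) :
    ∃ m, a < m ∧ ∀ j b, k < j → IsKthElement s j b → m ≤ b := by
  classical
  by_cases hex : ∃ j, k < j ∧ ∃ b, IsKthElement s j b
  · obtain ⟨hkj, m, hm⟩ := Nat.find_spec hex
    exact ⟨m, (ha.lt_iff_index_lt hm).2 hkj, fun j b hj hb =>
      (hm.le_iff_index_le hb).2 (Nat.find_min' hex ⟨hj, b, hb⟩)⟩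
  · obtain ⟨m, hm⟩ := exists_gt a
    exact ⟨m, hm, fun j b hj hb => absurd ⟨j, hj, b, hb⟩ hex⟩

end IsKthElement

end KthElement

section SolutionOperator

variable {n : ℕ} {h : Rn n → ℝ} (hb : MemLp h ∞ (volume : Measure (Rn n))) {μ : ℝ}

lemma isSymmetric_solOp : (solOp hb : H1 n →ₗ[ℝ] H1 n).IsSymmetric := by
  intro u v
  rw [ContinuousLinearMap.coe_coe, inner_solOp, real_inner_comm, inner_solOp]
  simp only [mul_right_comm]

lemma isPositive_solOp (hnonneg : 0 ≤ᵐ[volume] h) : (solOp hb).IsPositive := by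
  refine ⟨isSymmetric_solOp hb, fun u => ?_⟩
  rw [ContinuousLinearMap.reApplyInnerSelf_apply, RCLike.re_to_real, inner_solOp]
  refine integral_nonneg_of_ae ?_
  filter_upwards [hnonneg] with x hx
  rw [mul_assoc]
  exact mul_nonneg hx (mul_self_nonneg (u.fn x))

lemma mem_eigenspace_iff {u : H1 n} : u ∈ eigenspace hb μ ↔ u = μ • solOp hb u :=
  isWeakSolution_iff hb μ u u

lemma eigenspace_eq_eigenspace_solOp (hμ : μ ≠ 0) :
    eigenspace hb μ = Module.End.eigenspace (solOp hb : H1 n →ₗ[ℝ] H1 n) μ⁻¹ := by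
  ext u
  rw [mem_eigenspace_iff, Module.End.mem_eigenspace_iff, ContinuousLinearMap.coe_coe,
    eq_inv_smul_iff₀ hμ, eq_comm]

lemma ne_zero_of_mem_eigenvalues (hμ : μ ∈ eigenvalues hb) : μ ≠ 0 := by
  rintro rfl
  obtain ⟨u, hu, hu0⟩ := hμ
  exact hu0 (by rw [(mem_eigenspace_iff hb).1 hu, zero_smul])

lemma hasEigenvalue_solOp_of_mem_eigenvalues (hμ : μ ∈ eigenvalues hb) :
    Module.End.HasEigenvalue (solOp hb : H1 n →ₗ[ℝ] H1 n) μ⁻¹ := by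
  have hμ0 := ne_zero_of_mem_eigenvalues hb hμ
  obtain ⟨u, hu, hu0⟩ := hμ
  rw [eigenspace_eq_eigenspace_solOp hb hμ0] at hu
  exact Module.End.hasEigenvalue_of_hasEigenvector ⟨hu, hu0⟩

lemma pos_of_mem_eigenvalues (hnonneg : 0 ≤ᵐ[volume] h) (hμ : μ ∈ eigenvalues hb) : 0 < μ := by
  have hinv : 0 ≤ μ⁻¹ := eigenvalue_nonneg_of_nonneg (hasEigenvalue_solOp_of_mem_eigenvalues hb hμ)
    (isPositive_solOp hb hnonneg).re_inner_nonneg_right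
  exact (inv_nonneg.1 hinv).lt_of_ne' (ne_zero_of_mem_eigenvalues hb hμ)

lemma inner_opL_self (lam : ℝ) (u : H1 n) :
    inner ℝ (opL hb lam u) u = ‖u‖ ^ 2 - lam * inner ℝ (solOp hb u) u := by
  rw [opL, sub_apply, smul_apply, inner_sub_left, real_inner_smul_left,
    ContinuousLinearMap.id_apply, real_inner_self_eq_norm_sq]

end SolutionOperator

section Xplus

variable {n : ℕ} {h : Rn n → ℝ} {hb : MemLp h ∞ (volume : Measure (Rn n))} {k : ℕ} {m : ℝ}

lemma Xplus_le_closure_iSup_eigenspace (hm : 0 < m)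
    (hle : ∀ j μ, k < j → IsKthEigenvalue hb j μ → m ≤ μ) :
    Xplus hb k ≤ (⨆ (a : ℝ) (_ : a ≤ m⁻¹),
      Module.End.eigenspace (solOp hb : H1 n →ₗ[ℝ] H1 n) a).topologicalClosure := by
  refine Submodule.topologicalClosure_mono (iSup₂_le fun j hj => iSup₂_le fun μ hμ => ?_)
  have hmμ : m ≤ μ := hle j μ hj hμ
  rw [eigenspace_eq_eigenspace_solOp hb (hm.trans_le hmμ).ne']
  exact le_iSup₂_of_le μ⁻¹ (inv_anti₀ hm hmμ) le_rfl

lemma inner_solOp_self_le_of_mem_Xplus (hm : 0 < m)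
    (hle : ∀ j μ, k < j → IsKthEigenvalue hb j μ → m ≤ μ) {u : H1 n} (hu : u ∈ Xplus hb k) :
    inner ℝ (solOp hb u) u ≤ m⁻¹ * ‖u‖ ^ 2 :=
  reApplyInnerSelf_le_of_mem_closure_iSup_eigenspace (isSymmetric_solOp hb)
    (Xplus_le_closure_iSup_eigenspace hm hle hu)

lemma le_inner_opL_self_of_mem_Xplus {lam : ℝ} (hlam : 0 ≤ lam) (hm : 0 < m)
    (hle : ∀ j μ, k < j → IsKthEigenvalue hb j μ → m ≤ μ) {u : H1 n} (hu : u ∈ Xplus hb k) :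
    (1 - lam / m) * ‖u‖ ^ 2 ≤ inner ℝ (opL hb lam u) u := by
  calc (1 - lam / m) * ‖u‖ ^ 2
      = ‖u‖ ^ 2 - lam * (m⁻¹ * ‖u‖ ^ 2) := by ring
    _ ≤ ‖u‖ ^ 2 - lam * inner ℝ (solOp hb u) u := by
        gcongr
        exact inner_solOp_self_le_of_mem_Xplus hm hle hu
    _ = inner ℝ (opL hb lam u) u := (inner_opL_self hb lam u).symm

end Xplus

end Resonance

open Resonance in
theorem proposition3_general {n : ℕ} {h : Rn n → ℝ} (hnonneg : 0 ≤ᵐ[volume] h)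
    {hbdd : MemLp h ∞ volume} {k : ℕ} {lamk : ℝ} (hk : IsKthEigenvalue hbdd k lamk) :
    (∃ α : ℝ, 0 < α ∧ ∀ u ∈ Xplus hbdd k, α * ‖u‖ ^ 2 ≤ inner ℝ (opL hbdd lamk u) u) ∧
    ∀ lamk1 : ℝ, IsKthEigenvalue hbdd (k + 1) lamk1 →
      0 < 1 - lamk / lamk1 ∧ ∀ u ∈ Xplus hbdd k,
        (1 - lamk / lamk1) * ‖u‖ ^ 2 ≤ inner ℝ (opL hbdd lamk u) u := by
  have hpos : 0 < lamk := pos_of_mem_eigenvalues hbdd hnonneg hk.1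
  have bound : ∀ m, lamk < m → (∀ j μ, k < j → IsKthEigenvalue hbdd j μ → m ≤ μ) →
      0 < 1 - lamk / m ∧ ∀ u ∈ Xplus hbdd k,
        (1 - lamk / m) * ‖u‖ ^ 2 ≤ inner ℝ (opL hbdd lamk u) u := fun m hlt hle =>
    ⟨sub_pos.2 ((div_lt_one (hpos.trans hlt)).2 hlt), fun _ hu =>
      le_inner_opL_self_of_mem_Xplus hpos.le (hpos.trans hlt) hle hu⟩
  constructor
  · obtain ⟨m, hlt, hle⟩ := IsKthElement.exists_gt_forall_le hk
    exact ⟨1 - lamk / m, bound m hlt hle⟩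
  · intro lamk1 hk1
    exact bound lamk1 ((IsKthElement.lt_iff_index_lt hk hk1).2 k.lt_succ_self) fun j μ hj hμ =>
      (IsKthElement.le_iff_index_le hk1 hμ).2 hj

theorem proposition3 (n : ℕ) (hn : 3 ≤ n) (h : Resonance.Rn n → ℝ) (hcont : Continuous h)
    (hnonneg : ∀ x, 0 ≤ h x) (hint : Integrable h volume) (hbdd : MemLp h ∞ volume)
    (k : ℕ) (lamk : ℝ) (hk : Resonance.IsKthEigenvalue hbdd k lamk) :
    (∃ α : ℝ, 0 < α ∧ ∀ u ∈ Resonance.Xplus hbdd k,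
      α * ‖u‖ ^ 2 ≤ inner ℝ (Resonance.opL hbdd lamk u) u) ∧
    ∀ lamk1 : ℝ, Resonance.IsKthEigenvalue hbdd (k + 1) lamk1 →
      0 < 1 - lamk / lamk1 ∧ ∀ u ∈ Resonance.Xplus hbdd k,
        (1 - lamk / lamk1) * ‖u‖ ^ 2 ≤ inner ℝ (Resonance.opL hbdd lamk u) u :=
  proposition3_general (ae_of_all _ hnonneg) hk
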